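/- Let $\alpha>0>\beta$, and equip $SL(n,\mathbb R)$ with the left-invariant Riemannian metric given on its Lie algebra $sl(n,\mathbb R)$ by $$\langle X,Y\rangle=\alpha\operatorname{Tr}(\operatorname{sym}X\,\operatorname{sym}Y)+\beta\operatorname{Tr}(\operatorname{skew}X\,\operatorname{skew}Y),\qquad \operatorname{sym}X=\tfrac12(X+X^{\top}),\quad \operatorname{skew}X=\tfrac12(X-X^{\top}).$$ Let $X_n=SL(n,\mathbb R)/SO(n)$ carry the metric for which the projection $\pi:SL(n,\mathbb R)\to X_n$ is a Riemannian submersion. Let $g$ be a geodesic of $SL(n,\mathbb R)$ defined on an open interval $J$, let $t_0\in J$, and put $$\Omega_0=g(t_0)^{-1}\dot g(t_0),\qquad X_0=\Omega_0-k\operatorname{skew}\Omega_0,\qquad k=1-\frac{\beta}{\alpha}.$$ Then $\Omega_0,X_0\in sl(n,\mathbb R)$, and the projection of $g$ is the translate by $g(t_0)$ of the orbit of the base point $o=\pi(1)$ under the one-parameter subgroup $s\mapsto e^{sX_0}$ of $SL(n,\mathbb R)$: $$\pi(g(t))=g(t_0)\cdot\bigl(e^{(t-t_0)X_0}\cdot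 o\bigr)\qquad\text{for all }t\in J.$$ If the projected curve $\pi\circ g$ is not constant, then it can be parametrised by arc length and it has constant geodesic curvature: for some real number $\kappa$, the norm of the covariant derivative, in the Levi-Civita connection of $X_n$, of the velocity of $\pi\circ g$ with respect to arc length is equal to $\kappa$ at each point. -/

import Mathlib

open Matrix
open scoped ContDiff

/-! ### Riemannian geometry of a submanifold `S` of a vector space `E`

A Riemannian metric on `S` is given by `h : E → E → E → ℝ`, where `h p v w` is the inner product
of the vectors `v`, `w` at the point `p`; the function `h` is smooth and bilinear for `p` in a
neighbourhood of `S` and positive definite on the tangent spaces of `S`. -/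

section Riemannian

variable {E : Type*} [NormedAddCommGroup E] [NormedSpace ℝ E]

/-- The tangent space of `S ⊆ E` at `p`: velocities at `p` of the smooth curves in `S`. -/
def tangentVectors (S : Set E) (p : E) : Set E :=
  {v | ∃ c : ℝ → E, ContDiff ℝ ∞ c ∧ (∀ s, c s ∈ S) ∧ c 0 = p ∧ deriv c 0 = v}

/-- The Christoffel symbols of the first kind of `h`, that is `h_p(Γ_p(u, v), w)`. -/
noncomputable def christoffelFirst (h : E → E → E → ℝ) (p u v w : E) : ℝ :=
  (fderiv ℝ (fun x => h x v w) p u + fderiv ℝ (fun x => h x u w) p v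
    - fderiv ℝ (fun x => h x u v) p w) / 2

/-- `a` is the covariant derivative `Dċ/dt` at time `t` of the velocity of the curve `c` in `S`,
for the Levi-Civita connection of the metric `h` on `S`: the tangent vector of `S` with
`h(a, w) = h(c̈ + Γ(ċ, ċ), w)` for all tangent vectors `w` of `S`. -/
def IsCovDerivVelocity (S : Set E) (h : E → E → E → ℝ) (c : ℝ → E) (t : ℝ) (a : E) : Prop :=
  a ∈ tangentVectors S (c t) ∧ ∀ w ∈ tangentVectors S (c t),
    h (c t) a w =
      h (c t) (deriv (deriv c) t) w + christoffelFirst h (c t) (deriv c t) (deriv c t) w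

/-- `c` is a geodesic of `(S, h)` on the open interval `J`: its velocity is parallel. -/
def IsRiemannianGeodesicOn (S : Set E) (h : E → E → E → ℝ) (c : ℝ → E) (J : Set ℝ) : Prop :=
  (∀ t ∈ J, c t ∈ S) ∧ ContDiffOn ℝ 2 c J ∧ ∀ t ∈ J, IsCovDerivVelocity S h c t 0

/-- `c` is parametrised by arc length on `I`. -/
def IsUnitSpeedOn (h : E → E → E → ℝ) (c : ℝ → E) (I : Set ℝ) : Prop :=
  ContDiffOn ℝ 2 c I ∧ ∀ s ∈ I, h (c s) (deriv c s) (deriv c s) = 1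

/-- The curve `c` in `(S, h)`, defined on the open interval `J`, can be parametrised by arc length,
`s ↦ c (θ s)` with `s` in an open interval `I`, and its geodesic curvature, the norm of the
covariant derivative of the velocity in this parametrisation, is equal to `κ` at each point. -/
def HasConstantGeodesicCurvatureOn (S : Set E) (h : E → E → E → ℝ) (c : ℝ → E) (J : Set ℝ)
    (κ : ℝ) : Prop :=
  ∃ (I : Set ℝ) (θ : ℝ → ℝ), IsOpen I ∧ I.OrdConnected ∧ Set.BijOn θ I J ∧
    ContDiffOn ℝ ∞ θ I ∧ StrictMonoOn θ I ∧ IsUnitSpeedOn h (c ∘ θ) I ∧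
    ∀ s ∈ I, ∃ a, IsCovDerivVelocity S h (c ∘ θ) s a ∧ √(h (c (θ s)) a a) = κ

end Riemannian

/-! ### The group `SL(n, ℝ)` and its naturally reductive metrics -/

attribute [local instance] Matrix.normedAddCommGroup Matrix.normedSpace

/-- The symmetric part of a matrix. -/
noncomputable def symPart {n : ℕ} (X : Matrix (Fin n) (Fin n) ℝ) : Matrix (Fin n) (Fin n) ℝ :=
  (1 / 2 : ℝ) • (X + Xᵀ)

/-- The skew-symmetric part of a matrix. -/
noncomputable def skewPart {n : ℕ} (X : Matrix (Fin n) (Fin n) ℝ) : Matrix (Fin n) (Fin n) ℝ :=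
  (1 / 2 : ℝ) • (X - Xᵀ)

/-- The inner product `α Tr(sym X sym Y) + β Tr(skew X skew Y)`. -/
noncomputable def naturalForm {n : ℕ} (α β : ℝ) (X Y : Matrix (Fin n) (Fin n) ℝ) : ℝ :=
  α * (symPart X * symPart Y).trace + β * (skewPart X * skewPart Y).trace

/-- The left-invariant metric on `SL(n, ℝ)` whose value at the identity is `naturalForm α β`. -/
noncomputable def slMetric {n : ℕ} (α β : ℝ) (g V W : Matrix (Fin n) (Fin n) ℝ) : ℝ :=
  naturalForm α β (g⁻¹ * V) (g⁻¹ * W)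

/-- `g` is a geodesic on the interval `J` of `SL(n, ℝ)`, as a submanifold of the space of matrices,
with the metric `slMetric α β`. -/
def IsSLGeodesicOn {n : ℕ} (α β : ℝ) (g : ℝ → SpecialLinearGroup (Fin n) ℝ) (J : Set ℝ) : Prop :=
  IsRiemannianGeodesicOn
    (Set.range fun u : SpecialLinearGroup (Fin n) ℝ => (u : Matrix (Fin n) (Fin n) ℝ))
    (slMetric α β) (fun t => (g t : Matrix (Fin n) (Fin n) ℝ)) J

/-! ### The symmetric space `X_n = SL(n, ℝ) / SO(n)` -/

/-- `SO(n)` as a subgroup of `SL(n, ℝ)`. -/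
def subgroupSO (n : ℕ) : Subgroup (SpecialLinearGroup (Fin n) ℝ) where
  carrier := {k | (k : Matrix (Fin n) (Fin n) ℝ) ∈ specialOrthogonalGroup (Fin n) ℝ}
  one_mem' := by
    exact (specialOrthogonalGroup (Fin n) ℝ).one_mem
  mul_mem' := by
    intro a b ha hb
    exact (specialOrthogonalGroup (Fin n) ℝ).mul_mem ha hb
  inv_mem' := by
    intro a ha
    have h1 : (a : Matrix (Fin n) (Fin n) ℝ) ∈ orthogonalGroup (Fin n) ℝ :=
      (mem_specialOrthogonalGroup_iff.mp ha).1
    have h2 : (a : Matrix (Fin n) (Fin n) ℝ) * star (a : Matrix (Fin n) (Fin n) ℝ) = 1 :=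
      mem_orthogonalGroup_iff _ _ |>.mp h1
    have h3 : ((a⁻¹ : SpecialLinearGroup (Fin n) ℝ) : Matrix (Fin n) (Fin n) ℝ)
        = star (a : Matrix (Fin n) (Fin n) ℝ) := by
      have h4 : ((a⁻¹ : SpecialLinearGroup (Fin n) ℝ) : Matrix (Fin n) (Fin n) ℝ)
          * (a : Matrix (Fin n) (Fin n) ℝ) = 1 :=
        congrArg Subtype.val (inv_mul_cancel a)
      exact left_inv_eq_right_inv h4 h2
    refine mem_specialOrthogonalGroup_iff.mpr ⟨?_, (a⁻¹).2⟩
    rw [h3]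
    exact Unitary.star_mem h1

theorem mem_subgroupSO_iff {n : ℕ} (k : SpecialLinearGroup (Fin n) ℝ) :
    k ∈ subgroupSO n ↔
      (k : Matrix (Fin n) (Fin n) ℝ) * (k : Matrix (Fin n) (Fin n) ℝ)ᵀ = 1 := by
  constructor
  · intro h
    exact mem_orthogonalGroup_iff _ _ |>.mp (mem_specialOrthogonalGroup_iff.mp h).1
  · intro h
    exact mem_specialOrthogonalGroup_iff.mpr ⟨mem_orthogonalGroup_iff _ _ |>.mpr h, k.2⟩

/-- The symmetric space `SL(n, ℝ) / SO(n)`. -/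
abbrev SymSpace (n : ℕ) : Type := SpecialLinearGroup (Fin n) ℝ ⧸ subgroupSO n

/-- The standard embedding `g SO(n) ↦ g gᵀ` of `SL(n, ℝ) / SO(n)` into the space of matrices. It
identifies `SL(n, ℝ) / SO(n)` with the submanifold of the positive definite symmetric matrices of
determinant one. -/
def symSpaceEmb {n : ℕ} : SymSpace n → Matrix (Fin n) (Fin n) ℝ :=
  Quotient.lift
    (fun g : SpecialLinearGroup (Fin n) ℝ =>
      (g : Matrix (Fin n) (Fin n) ℝ) * (g : Matrix (Fin n) (Fin n) ℝ)ᵀ) (by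
    intro a b hab
    have h := (mem_subgroupSO_iff _).mp (QuotientGroup.leftRel_apply.mp hab)
    have hb : (b : Matrix (Fin n) (Fin n) ℝ)
        = a * ((a⁻¹ * b : SpecialLinearGroup (Fin n) ℝ) : Matrix (Fin n) (Fin n) ℝ) :=
      congrArg Subtype.val (mul_inv_cancel_left a b).symm
    change (a : Matrix (Fin n) (Fin n) ℝ) * (a : Matrix (Fin n) (Fin n) ℝ)ᵀ
      = (b : Matrix (Fin n) (Fin n) ℝ) * (b : Matrix (Fin n) (Fin n) ℝ)ᵀ
    rw [hb, transpose_mul, Matrix.mul_assoc, ← Matrix.mul_assoc _ _ (a : Matrix (Fin n) (Fin n) ℝ)ᵀ, h,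
      Matrix.one_mul])

theorem symSpaceEmb_mk {n : ℕ} (g : SpecialLinearGroup (Fin n) ℝ) :
    symSpaceEmb (g : SymSpace n) =
      (g : Matrix (Fin n) (Fin n) ℝ) * (g : Matrix (Fin n) (Fin n) ℝ)ᵀ := rfl

theorem symSpaceEmb_injective {n : ℕ} :
    Function.Injective (symSpaceEmb : SymSpace n → Matrix (Fin n) (Fin n) ℝ) := by
  intro x y
  induction x using QuotientGroup.induction_on with | _ a
  induction y using QuotientGroup.induction_on with | _ b
  intro h
  rw [symSpaceEmb_mk, symSpaceEmb_mk] at h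
  have h1 : ((a⁻¹ : SpecialLinearGroup (Fin n) ℝ) : Matrix (Fin n) (Fin n) ℝ)
      * (a : Matrix (Fin n) (Fin n) ℝ) = 1 :=
    congrArg Subtype.val (inv_mul_cancel a)
  have h2 : ((a⁻¹ * b : SpecialLinearGroup (Fin n) ℝ) : Matrix (Fin n) (Fin n) ℝ)
      = ((a⁻¹ : SpecialLinearGroup (Fin n) ℝ) : Matrix (Fin n) (Fin n) ℝ)
        * (b : Matrix (Fin n) (Fin n) ℝ) := rfl
  rw [QuotientGroup.eq, mem_subgroupSO_iff, h2, transpose_mul, Matrix.mul_assoc,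
    ← Matrix.mul_assoc (b : Matrix (Fin n) (Fin n) ℝ), ← h, Matrix.mul_assoc, ← transpose_mul,
    ← Matrix.mul_assoc, h1, transpose_one, Matrix.one_mul]

/-- The metric on `SL(n, ℝ) / SO(n)` (embedded by `symSpaceEmb`) for which the projection from
`SL(n, ℝ)` with the metric `slMetric α β` is a Riemannian submersion; see
`symSpaceMetric_submersion`. -/
noncomputable def symSpaceMetric {n : ℕ} (α : ℝ) (P V W : Matrix (Fin n) (Fin n) ℝ) : ℝ :=
  α / 4 * (P⁻¹ * V * (P⁻¹ * W)).trace

/-- The tangent vector `g Ω` of `SL(n, ℝ)` at `g` is mapped by the differential of the projection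
`g ↦ g gᵀ` to `g Ω gᵀ + g Ωᵀ gᵀ`. It is vertical if `Ω` is skew-symmetric, so that it is
horizontal if `Ω` is symmetric; on the horizontal vectors the differential is isometric. -/
theorem symSpaceMetric_submersion {n : ℕ} (α β : ℝ) (g : SpecialLinearGroup (Fin n) ℝ)
    (Ω Ω' : Matrix (Fin n) (Fin n) ℝ) (hΩ : Ωᵀ = Ω) (hΩ' : Ω'ᵀ = Ω') :
    symSpaceMetric α (symSpaceEmb (g : SymSpace n))
        ((g : Matrix (Fin n) (Fin n) ℝ) * Ω * (g : Matrix (Fin n) (Fin n) ℝ)ᵀ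
          + (g : Matrix (Fin n) (Fin n) ℝ) * Ωᵀ * (g : Matrix (Fin n) (Fin n) ℝ)ᵀ)
        ((g : Matrix (Fin n) (Fin n) ℝ) * Ω' * (g : Matrix (Fin n) (Fin n) ℝ)ᵀ
          + (g : Matrix (Fin n) (Fin n) ℝ) * Ω'ᵀ * (g : Matrix (Fin n) (Fin n) ℝ)ᵀ)
      = slMetric α β (g : Matrix (Fin n) (Fin n) ℝ) ((g : Matrix (Fin n) (Fin n) ℝ) * Ω)
        ((g : Matrix (Fin n) (Fin n) ℝ) * Ω') := by
  have hg : IsUnit (g : Matrix (Fin n) (Fin n) ℝ).det := by rw [g.2]; exact isUnit_one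
  have hgt : IsUnit ((g : Matrix (Fin n) (Fin n) ℝ)ᵀ).det := by rwa [det_transpose]
  have key : ∀ Z : Matrix (Fin n) (Fin n) ℝ,
      ((g : Matrix (Fin n) (Fin n) ℝ) * (g : Matrix (Fin n) (Fin n) ℝ)ᵀ)⁻¹
        * ((g : Matrix (Fin n) (Fin n) ℝ) * Z * (g : Matrix (Fin n) (Fin n) ℝ)ᵀ)
      = ((g : Matrix (Fin n) (Fin n) ℝ)ᵀ)⁻¹ * Z * (g : Matrix (Fin n) (Fin n) ℝ)ᵀ := by
    intro Z
    rw [Matrix.mul_inv_rev, Matrix.mul_assoc _ _ (_ * _ * _), ← Matrix.mul_assoc _ (_ * _),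
      nonsing_inv_mul_cancel_left _ _ hg, Matrix.mul_assoc]
  have key2 : ∀ Z Z' : Matrix (Fin n) (Fin n) ℝ,
      (((g : Matrix (Fin n) (Fin n) ℝ)ᵀ)⁻¹ * Z * (g : Matrix (Fin n) (Fin n) ℝ)ᵀ
        * (((g : Matrix (Fin n) (Fin n) ℝ)ᵀ)⁻¹ * Z' * (g : Matrix (Fin n) (Fin n) ℝ)ᵀ)).trace
      = (Z * Z').trace := by
    intro Z Z'
    rw [Matrix.trace_mul_comm, Matrix.mul_assoc _ _ (_ * _ * _), Matrix.mul_assoc _ Z,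
      mul_nonsing_inv_cancel_left _ _ hgt, Matrix.mul_assoc, Matrix.trace_mul_comm,
      Matrix.mul_assoc, Matrix.mul_assoc, mul_nonsing_inv _ hgt, Matrix.mul_one,
      Matrix.trace_mul_comm]
  simp only [symSpaceMetric, slMetric, naturalForm, symSpaceEmb_mk, hΩ, hΩ', symPart, skewPart,
    nonsing_inv_mul_cancel_left _ _ hg, sub_self, smul_zero, trace_zero, mul_zero,
    add_zero, Matrix.mul_add, key, Matrix.add_mul, trace_add, key2, smul_add, Matrix.smul_mul,
    Matrix.mul_smul, trace_smul, smul_eq_mul]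
  ring

/-!
Write `Ω = g⁻¹ ġ = S + K` with `S` symmetric and `K` skew-symmetric, and `k = 1 - β / α`. Tested
on the tangent vectors `g W`, `Tr W = 0`, the geodesic equation of the left-invariant metric becomes
the Euler–Arnold equation `⟨Ω', W⟩ = ⟨Ω, [Ω, W]⟩`. Its right-hand side is
`Tr([α S + β K, S + K] W) = (α - β) Tr([S, K] W)`, and `[S, K]` is symmetric, so that `K' = 0` and
`S' = k [S, K]` (`eq_smul_commutator_of_naturalForm_eq`,
`hasDerivAt_inv_mul_deriv_of_isRiemannianGeodesicOn`).

Hence `e^{skK} (Ω - k K) e^{-skK}`, with `s = t - t₀`, is constant and equal to `X₀`; it is the body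
velocity of `g e^{-skK}`, so that `g(t) = g(t₀) e^{sX₀} e^{skK}`
(`eq_mul_exp_mul_exp_of_hasDerivAt`). The last factor lies in `SO(n)`, because `K` is
skew-symmetric, and the projection of `g` is the translated orbit.

In the model of `X_n` by the matrices `P = b bᵀ`, the Levi-Civita connection is given by
`Γ(V, V) = -V P⁻¹ V` (`christoffelFirst_symSpaceMetric`). For a curve `b` with `b' = b Y`, `Y`
constant, the velocity of `b bᵀ` is `b (Y + Yᵀ) bᵀ` and its covariant derivative is `b [Y, Yᵀ] bᵀ`
(`isCovDerivVelocity_mul_transpose`). The norm of `b Z bᵀ` at `b bᵀ` is `√(α / 4 Tr Z²)`, whatever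
`b` is. Speed and geodesic curvature of the orbit are therefore constant, and the speed vanishes
only if `X₀` is skew-symmetric, in which case the orbit is a point.
-/

/-! ### Calculus of matrix-valued functions -/

section MatrixCalculus

variable {m : Type*} [Fintype m] {E : Type*} [NormedAddCommGroup E] [NormedSpace ℝ E]

theorem HasDerivAt.matrix_mul {F G : ℝ → Matrix m m ℝ} {F' G' : Matrix m m ℝ} {t : ℝ}
    (hF : HasDerivAt F F' t) (hG : HasDerivAt G G' t) :
    HasDerivAt (fun s => F s * G s) (F' * G t + F t * G') t := by
  refine hasDerivAt_pi.2 fun i => hasDerivAt_pi.2 fun j => ?_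
  have h := HasDerivAt.fun_sum (u := Finset.univ) fun k _ =>
    (hasDerivAt_pi.1 (hasDerivAt_pi.1 hF i) k).mul (hasDerivAt_pi.1 (hasDerivAt_pi.1 hG k) j)
  simpa [Matrix.mul_apply, Finset.sum_add_distrib] using h

theorem HasDerivAt.matrix_transpose {F : ℝ → Matrix m m ℝ} {F' : Matrix m m ℝ} {t : ℝ}
    (hF : HasDerivAt F F' t) : HasDerivAt (fun s => (F s)ᵀ) F'ᵀ t :=
  hasDerivAt_pi.2 fun i => hasDerivAt_pi.2 fun j => hasDerivAt_pi.1 (hasDerivAt_pi.1 hF j) i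

theorem HasDerivAt.matrix_trace {F : ℝ → Matrix m m ℝ} {F' : Matrix m m ℝ} {t : ℝ}
    (hF : HasDerivAt F F' t) : HasDerivAt (fun s => (F s).trace) F'.trace t :=
  HasDerivAt.fun_sum fun i _ => hasDerivAt_pi.1 (hasDerivAt_pi.1 hF i) i

theorem DifferentiableAt.matrix_mul {F G : E → Matrix m m ℝ} {x : E}
    (hF : DifferentiableAt ℝ F x) (hG : DifferentiableAt ℝ G x) :
    DifferentiableAt ℝ (fun y => F y * G y) x := by
  refine differentiableAt_pi.2 fun i => differentiableAt_pi.2 fun j => ?_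
  simp only [Matrix.mul_apply]
  exact DifferentiableAt.fun_sum fun k _ =>
    (differentiableAt_pi.1 (differentiableAt_pi.1 hF i) k).mul
      (differentiableAt_pi.1 (differentiableAt_pi.1 hG k) j)

theorem DifferentiableAt.matrix_transpose {F : E → Matrix m m ℝ} {x : E}
    (hF : DifferentiableAt ℝ F x) : DifferentiableAt ℝ (fun y => (F y)ᵀ) x :=
  differentiableAt_pi.2 fun i => differentiableAt_pi.2 fun j =>
    differentiableAt_pi.1 (differentiableAt_pi.1 hF j) i

theorem DifferentiableAt.matrix_trace {F : E → Matrix m m ℝ} {x : E}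
    (hF : DifferentiableAt ℝ F x) : DifferentiableAt ℝ (fun y => (F y).trace) x :=
  DifferentiableAt.fun_sum fun i _ => differentiableAt_pi.1 (differentiableAt_pi.1 hF i) i

theorem ContDiff.matrix_mul {F G : E → Matrix m m ℝ} {r : WithTop ℕ∞}
    (hF : ContDiff ℝ r F) (hG : ContDiff ℝ r G) : ContDiff ℝ r (fun y => F y * G y) := by
  refine contDiff_pi.2 fun i => contDiff_pi.2 fun j => ?_
  simp only [Matrix.mul_apply]
  exact ContDiff.sum fun k _ =>
    (contDiff_pi.1 (contDiff_pi.1 hF i) k).mul (contDiff_pi.1 (contDiff_pi.1 hG k) j)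

theorem ContDiff.matrix_transpose {F : E → Matrix m m ℝ} {r : WithTop ℕ∞}
    (hF : ContDiff ℝ r F) : ContDiff ℝ r (fun y => (F y)ᵀ) :=
  contDiff_pi.2 fun i => contDiff_pi.2 fun j => contDiff_pi.1 (contDiff_pi.1 hF j) i

variable [DecidableEq m]

theorem hasDerivAt_matrix_exp_smul (X : Matrix m m ℝ) (t : ℝ) :
    HasDerivAt (fun s : ℝ => NormedSpace.exp (s • X)) (NormedSpace.exp (t • X) * X) t := by
  -- The entrywise sup norm is not submultiplicative; a submultiplicative norm inducing the same
  -- topology makes the matrices a Banach algebra.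
  let _ : NormedRing (Matrix m m ℝ) := Matrix.linftyOpNormedRing
  let _ : NormedAlgebra ℝ (Matrix m m ℝ) := Matrix.linftyOpNormedAlgebra
  have _ : @CompleteSpace (Matrix m m ℝ) PseudoMetricSpace.toUniformSpace :=
    inferInstanceAs (CompleteSpace (m → m → ℝ))
  exact hasDerivAt_exp_smul_const X t

theorem matrix_exp_smul_mul_comm (X : Matrix m m ℝ) (t : ℝ) :
    NormedSpace.exp (t • X) * X = X * NormedSpace.exp (t • X) := by
  exact (((Commute.refl X).smul_right t).exp_right).eq.symm

theorem matrix_exp_add_smul (X : Matrix m m ℝ) (s t : ℝ) :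
    NormedSpace.exp ((s + t) • X) = NormedSpace.exp (s • X) * NormedSpace.exp (t • X) := by
  rw [add_smul]
  exact Matrix.exp_add_of_commute _ _ (((Commute.refl X).smul_left s).smul_right t)

theorem matrix_exp_mul_exp_neg_smul (X : Matrix m m ℝ) (t : ℝ) :
    NormedSpace.exp (t • X) * NormedSpace.exp ((-t) • X) = 1 := by
  rw [← matrix_exp_add_smul, add_neg_cancel, zero_smul, NormedSpace.exp_zero]

theorem matrix_exp_neg_mul_exp_smul (X : Matrix m m ℝ) (t : ℝ) :
    NormedSpace.exp ((-t) • X) * NormedSpace.exp (t • X) = 1 := by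
  rw [← matrix_exp_add_smul, neg_add_cancel, zero_smul, NormedSpace.exp_zero]

theorem contDiff_matrix_exp_smul (X : Matrix m m ℝ) :
    ContDiff ℝ ∞ (fun s : ℝ => NormedSpace.exp (s • X)) := by
  refine contDiff_infty.2 fun r => ?_
  induction r with
  | zero =>
    exact contDiff_zero.2 (continuous_iff_continuousAt.2 fun t =>
      (hasDerivAt_matrix_exp_smul X t).continuousAt)
  | succ r ih =>
    have hd : deriv (fun s : ℝ => NormedSpace.exp (s • X))
        = fun s => NormedSpace.exp (s • X) * X :=
      funext fun t => (hasDerivAt_matrix_exp_smul X t).deriv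
    push_cast
    refine contDiff_succ_iff_deriv.2
      ⟨fun t => (hasDerivAt_matrix_exp_smul X t).differentiableAt, by simp, ?_⟩
    exact hd ▸ ih.matrix_mul contDiff_const

/-- The derivative of the inverse at `P` is `V ↦ -P⁻¹ V P⁻¹`. It is given by its values, so that its
statement does not refer to the submultiplicative norm used to obtain it. -/
theorem hasFDerivAt_matrix_inv {P : Matrix m m ℝ} (hP : IsUnit P) :
    ∃ D : Matrix m m ℝ →L[ℝ] Matrix m m ℝ,
      HasFDerivAt (fun x : Matrix m m ℝ => x⁻¹) D P ∧ ∀ V, D V = -(P⁻¹ * V * P⁻¹) := by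
  have hv : ((hP.unit⁻¹ : (Matrix m m ℝ)ˣ) : Matrix m m ℝ) = P⁻¹ := by
    rw [Matrix.coe_units_inv, IsUnit.unit_spec]
  let _ : NormedRing (Matrix m m ℝ) := Matrix.linftyOpNormedRing
  let _ : NormedAlgebra ℝ (Matrix m m ℝ) := Matrix.linftyOpNormedAlgebra
  have _ : @CompleteSpace (Matrix m m ℝ) PseudoMetricSpace.toUniformSpace :=
    inferInstanceAs (CompleteSpace (m → m → ℝ))
  have h := hasFDerivAt_ringInverse (𝕜 := ℝ) hP.unit
  rw [← funext (Matrix.nonsing_inv_eq_ringInverse (n := m) (α := ℝ))] at h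
  exact ⟨_, h, fun V => by rw [← hv]; rfl⟩

theorem differentiableAt_matrix_inv {P : Matrix m m ℝ} (hP : IsUnit P) :
    DifferentiableAt ℝ (fun x : Matrix m m ℝ => x⁻¹) P := by
  obtain ⟨D, hD, -⟩ := hasFDerivAt_matrix_inv hP
  exact hD.differentiableAt

theorem HasDerivAt.matrix_inv {F : ℝ → Matrix m m ℝ} {F' : Matrix m m ℝ} {t : ℝ}
    (hF : HasDerivAt F F' t) (hu : IsUnit (F t)) :
    HasDerivAt (fun s => (F s)⁻¹) (-((F t)⁻¹ * F' * (F t)⁻¹)) t := by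
  obtain ⟨D, hD, hDV⟩ := hasFDerivAt_matrix_inv hu
  rw [← hDV]
  exact hD.comp_hasDerivAt t hF

theorem differentiable_matrix_det : Differentiable ℝ (fun x : Matrix m m ℝ => x.det) := by
  simp only [Matrix.det_apply]
  have h : ContDiff ℝ 1 (fun x : Matrix m m ℝ => x) := contDiff_id
  refine ContDiff.differentiable (n := 1) ?_ one_ne_zero
  exact ContDiff.sum fun σ _ => ContDiff.const_smul _ (contDiff_prod fun i _ =>
    contDiff_pi.1 (contDiff_pi.1 h (σ i)) i)

theorem hasDerivAt_det_one_add_smul (M : Matrix m m ℝ) :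
    HasDerivAt (fun s : ℝ => (1 + s • M).det) M.trace 0 := by
  rw [funext fun s => Matrix.det_one_add_smul s M]
  generalize (det (1 + (Polynomial.X : Polynomial ℝ) • M.map Polynomial.C)).divX.divX = p
  have h : HasDerivAt (fun s : ℝ => 1 + M.trace * s + p.eval s * s ^ 2) _ 0 :=
    (((hasDerivAt_id' (0 : ℝ)).const_mul M.trace).const_add 1).add
      ((p.hasDerivAt 0).mul ((hasDerivAt_id' (0 : ℝ)).pow 2))
  simpa using h

/-- The derivative of the determinant at the identity is the trace. -/
theorem HasDerivAt.matrix_det_of_eq_one {F : ℝ → Matrix m m ℝ} {F' : Matrix m m ℝ} {t : ℝ}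
    (hF : HasDerivAt F F' t) (h1 : F t = 1) : HasDerivAt (fun s => (F s).det) F'.trace t := by
  have hd := (differentiable_matrix_det (F t)).hasFDerivAt
  have hl : HasDerivAt (fun s : ℝ => F t + s • F') F' 0 := by
    have h := ((hasDerivAt_id (0 : ℝ)).smul_const F').const_add (F t)
    rwa [one_smul] at h
  have h0 : F t = F t + (0 : ℝ) • F' := by simp
  have h2 := hd.comp_hasDerivAt t hF
  have h3 := HasFDerivAt.comp_hasDerivAt_of_eq (0 : ℝ) hd hl h0
  have h4 : HasDerivAt (fun s : ℝ => (F t + s • F').det) F'.trace 0 := by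
    rw [h1]; exact hasDerivAt_det_one_add_smul F'
  exact h3.unique h4 ▸ h2

/-- Jacobi's formula for the derivative of the determinant, at an invertible matrix. -/
theorem HasDerivAt.matrix_det {F : ℝ → Matrix m m ℝ} {F' : Matrix m m ℝ} {t : ℝ}
    (hF : HasDerivAt F F' t) (hu : IsUnit (F t)) :
    HasDerivAt (fun s => (F s).det) ((F t).det * ((F t)⁻¹ * F').trace) t := by
  have hud : IsUnit (F t).det := (Matrix.isUnit_iff_isUnit_det _).1 hu
  have h1 : HasDerivAt (fun s => (F t)⁻¹ * F s) ((F t)⁻¹ * F') t := by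
    simpa using (hasDerivAt_const t (F t)⁻¹).matrix_mul hF
  have h2 := h1.matrix_det_of_eq_one (Matrix.nonsing_inv_mul _ hud)
  have h3 := h2.const_mul (F t).det
  simpa only [Function.comp_def, ← Matrix.det_mul, Matrix.mul_nonsing_inv_cancel_left _ _ hud]
    using h3

theorem det_matrix_exp_smul {X : Matrix m m ℝ} (hX : X.trace = 0) (t : ℝ) :
    (NormedSpace.exp (t • X)).det = 1 := by
  have hd : ∀ s : ℝ, HasDerivAt (fun s : ℝ => (NormedSpace.exp (s • X)).det) 0 s := by
    intro s
    have hu : IsUnit (NormedSpace.exp (s • X)) := Matrix.isUnit_exp _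
    have h := (hasDerivAt_matrix_exp_smul X s).matrix_det hu
    rwa [Matrix.nonsing_inv_mul_cancel_left _ _ ((Matrix.isUnit_iff_isUnit_det _).1 hu), hX,
      mul_zero] at h
  have h := is_const_of_deriv_eq_zero (fun s => (hd s).differentiableAt) (fun s => (hd s).deriv) t 0
  simpa using h

end MatrixCalculus

/-! ### Curves in a submanifold of a normed space -/

section NormedSpaceCurves

variable {E : Type*} [NormedAddCommGroup E] [NormedSpace ℝ E]

/-- The Christoffel symbols are determined by the derivatives of `h` along three lines. -/
theorem christoffelFirst_eq_of_hasDerivAt {h : E → E → E → ℝ} {p u v w : E} {d₁ d₂ d₃ : ℝ}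
    (hd : ∀ v w, DifferentiableAt ℝ (fun x => h x v w) p)
    (h₁ : HasDerivAt (fun s : ℝ => h (p + s • u) v w) d₁ 0)
    (h₂ : HasDerivAt (fun s : ℝ => h (p + s • v) u w) d₂ 0)
    (h₃ : HasDerivAt (fun s : ℝ => h (p + s • w) u v) d₃ 0) :
    christoffelFirst h p u v w = (d₁ + d₂ - d₃) / 2 := by
  rw [christoffelFirst, ← (hd v w).lineDeriv_eq_fderiv, ← (hd u w).lineDeriv_eq_fderiv,
    ← (hd u v).lineDeriv_eq_fderiv, lineDeriv, lineDeriv, lineDeriv, h₁.deriv, h₂.deriv, h₃.deriv]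

theorem hasDerivAt_add_smul_zero (p u : E) : HasDerivAt (fun s : ℝ => p + s • u) u 0 := by
  simpa using ((hasDerivAt_id (0 : ℝ)).smul_const u).const_add p

theorem eq_of_hasDerivAt_zero {J : Set ℝ} (hJo : IsOpen J) (hJc : J.OrdConnected) {f : ℝ → E}
    (hf : ∀ t ∈ J, HasDerivAt f 0 t) {s t : ℝ} (hs : s ∈ J) (ht : t ∈ J) : f s = f t :=
  hJo.is_const_of_deriv_eq_zero hJc.isPreconnected
    (fun x hx => (hf x hx).differentiableAt.differentiableWithinAt) (fun x hx => (hf x hx).deriv)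
    hs ht

theorem ContDiffOn.hasDerivAt_deriv_of_isOpen {J : Set ℝ} (hJo : IsOpen J) {f : ℝ → E}
    (hf : ContDiffOn ℝ 2 f J) {t : ℝ} (ht : t ∈ J) :
    HasDerivAt f (deriv f t) t ∧ HasDerivAt (deriv f) (deriv (deriv f) t) t := by
  have h2 : ContDiffOn ℝ (1 + 1) f J := by simpa [one_add_one_eq_two] using hf
  have h := (contDiffOn_succ_iff_deriv_of_isOpen hJo).1 h2
  exact ⟨(h.1.differentiableAt (hJo.mem_nhds ht)).hasDerivAt,
    ((h.2.2.differentiableOn one_ne_zero).differentiableAt (hJo.mem_nhds ht)).hasDerivAt⟩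

/-- The covariant derivative of the velocity, computed from the first two derivatives. -/
theorem isCovDerivVelocity_of_hasDerivAt {S : Set E} {h : E → E → E → ℝ} {c c' : ℝ → E}
    {t : ℝ} {c'' a : E} (hc : ∀ᶠ s in nhds t, HasDerivAt c (c' s) s) (hc' : HasDerivAt c' c'' t)
    (ha : a ∈ tangentVectors S (c t))
    (heq : ∀ w, h (c t) a w = h (c t) c'' w + christoffelFirst h (c t) (c' t) (c' t) w) :
    IsCovDerivVelocity S h c t a := by
  have h1 : deriv c =ᶠ[nhds t] c' := hc.mono fun s hs => hs.deriv
  refine ⟨ha, fun w _ => ?_⟩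
  rw [h1.deriv_eq, hc'.deriv, h1.eq_of_nhds]
  exact heq w

/-- The defining equation of the covariant derivative, in terms of given derivatives. -/
theorem IsCovDerivVelocity.eq_of_hasDerivAt {S : Set E} {h : E → E → E → ℝ} {c : ℝ → E}
    {t : ℝ} {c' c'' a w : E} (ha : IsCovDerivVelocity S h c t a) (hw : w ∈ tangentVectors S (c t))
    (hc : HasDerivAt c c' t) (hc' : HasDerivAt (deriv c) c'' t) :
    h (c t) a w = h (c t) c'' w + christoffelFirst h (c t) c' c' w := by
  rw [← hc.deriv, ← hc'.deriv]
  exact ha.2 w hw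

end NormedSpaceCurves

/-! ### The left-invariant metric of `SL(n, ℝ)` -/

section NaturalForm

variable {n : ℕ} {α β : ℝ}

theorem transpose_symPart (X : Matrix (Fin n) (Fin n) ℝ) : (symPart X)ᵀ = symPart X := by
  simp [symPart, add_comm]

theorem transpose_skewPart (X : Matrix (Fin n) (Fin n) ℝ) : (skewPart X)ᵀ = -skewPart X := by
  simp [skewPart, ← smul_neg]

theorem symPart_add_skewPart (X : Matrix (Fin n) (Fin n) ℝ) : symPart X + skewPart X = X := by
  simp only [symPart, skewPart]
  module

theorem trace_symPart (X : Matrix (Fin n) (Fin n) ℝ) : (symPart X).trace = X.trace := by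
  simp only [symPart, trace_smul, trace_add, trace_transpose, smul_eq_mul]
  ring

theorem trace_skewPart (X : Matrix (Fin n) (Fin n) ℝ) : (skewPart X).trace = 0 := by
  simp [skewPart]

/-- Both summands of `naturalForm`, expressed by the traces of `X Y` and `X Yᵀ`. -/
theorem naturalForm_eq_trace (X Y : Matrix (Fin n) (Fin n) ℝ) :
    naturalForm α β X Y = (α + β) / 2 * (X * Y).trace + (α - β) / 2 * (X * Yᵀ).trace := by
  have h1 : (Xᵀ * Yᵀ).trace = (X * Y).trace := by
    rw [← Matrix.transpose_mul, trace_transpose, Matrix.trace_mul_comm]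
  have h2 : (Xᵀ * Y).trace = (X * Yᵀ).trace := by
    rw [← trace_transpose, Matrix.transpose_mul, Matrix.transpose_transpose, Matrix.trace_mul_comm]
  simp only [naturalForm, symPart, skewPart, Matrix.smul_mul, Matrix.mul_smul, trace_smul,
    Matrix.add_mul, Matrix.mul_add, Matrix.sub_mul, Matrix.mul_sub, trace_add, trace_sub,
    smul_eq_mul, h1, h2]
  ring

theorem naturalForm_eq_trace_mul (X Y : Matrix (Fin n) (Fin n) ℝ) :
    naturalForm α β X Y = ((α • symPart X + β • skewPart X) * Y).trace := by
  have h2 : (Xᵀ * Y).trace = (X * Yᵀ).trace := by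
    rw [← trace_transpose, Matrix.transpose_mul, Matrix.transpose_transpose, Matrix.trace_mul_comm]
  simp only [naturalForm_eq_trace, symPart, skewPart, Matrix.smul_mul, trace_smul,
    Matrix.add_mul, Matrix.sub_mul, trace_add, trace_sub, smul_eq_mul, h2]
  ring

theorem HasDerivAt.naturalForm {F G : ℝ → Matrix (Fin n) (Fin n) ℝ}
    {F' G' : Matrix (Fin n) (Fin n) ℝ} {t : ℝ} (hF : HasDerivAt F F' t) (hG : HasDerivAt G G' t) :
    HasDerivAt (fun s => naturalForm α β (F s) (G s))
      (naturalForm α β F' (G t) + naturalForm α β (F t) G') t := by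
  have h := (((hF.matrix_mul hG).matrix_trace.const_mul ((α + β) / 2))).add
    ((hF.matrix_mul hG.matrix_transpose).matrix_trace.const_mul ((α - β) / 2))
  simp only [naturalForm_eq_trace]
  refine h.congr_deriv ?_
  simp only [trace_add]
  ring

theorem differentiableAt_slMetric {P : Matrix (Fin n) (Fin n) ℝ} (hP : IsUnit P)
    (V W : Matrix (Fin n) (Fin n) ℝ) : DifferentiableAt ℝ (fun x => slMetric α β x V W) P := by
  have h : ∀ Z : Matrix (Fin n) (Fin n) ℝ,
      DifferentiableAt ℝ (fun x : Matrix (Fin n) (Fin n) ℝ => x⁻¹ * Z) P := fun Z =>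
    (differentiableAt_matrix_inv hP).matrix_mul (differentiableAt_const Z)
  simp only [slMetric, naturalForm_eq_trace]
  exact (((h V).matrix_mul (h W)).matrix_trace.const_mul _).add
    (((h V).matrix_mul (h W).matrix_transpose).matrix_trace.const_mul _)

theorem hasDerivAt_inv_add_smul_mul {P : Matrix (Fin n) (Fin n) ℝ} (hP : IsUnit P)
    (U V : Matrix (Fin n) (Fin n) ℝ) :
    HasDerivAt (fun s : ℝ => (P + s • U)⁻¹ * V) (-(P⁻¹ * U * (P⁻¹ * V))) 0 := by
  have h0 : P + (0 : ℝ) • U = P := by simp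
  have h := ((hasDerivAt_add_smul_zero P U).matrix_inv (by rwa [h0])).matrix_mul
    (hasDerivAt_const 0 V)
  refine h.congr_deriv ?_
  simp only [h0, Matrix.mul_zero, add_zero, Matrix.neg_mul, Matrix.mul_assoc]

theorem hasDerivAt_slMetric_add_smul {P : Matrix (Fin n) (Fin n) ℝ} (hP : IsUnit P)
    (U V W : Matrix (Fin n) (Fin n) ℝ) :
    HasDerivAt (fun s : ℝ => slMetric α β (P + s • U) V W)
      (naturalForm α β (-(P⁻¹ * U * (P⁻¹ * V))) (P⁻¹ * W)
        + naturalForm α β (P⁻¹ * V) (-(P⁻¹ * U * (P⁻¹ * W)))) 0 := by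
  have h0 : P + (0 : ℝ) • U = P := by simp
  have h := (hasDerivAt_inv_add_smul_mul hP U V).naturalForm (α := α) (β := β)
    (hasDerivAt_inv_add_smul_mul hP U W)
  simpa only [slMetric, h0] using h

theorem naturalForm_comm (X Y : Matrix (Fin n) (Fin n) ℝ) :
    naturalForm α β X Y = naturalForm α β Y X := by
  simp only [naturalForm]
  rw [Matrix.trace_mul_comm, Matrix.trace_mul_comm (skewPart X)]

theorem naturalForm_neg_left (X Y : Matrix (Fin n) (Fin n) ℝ) :
    naturalForm α β (-X) Y = -naturalForm α β X Y := by
  simp only [naturalForm_eq_trace, Matrix.neg_mul, trace_neg]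
  ring

theorem naturalForm_sub_left (X X' Y : Matrix (Fin n) (Fin n) ℝ) :
    naturalForm α β (X - X') Y = naturalForm α β X Y - naturalForm α β X' Y := by
  simp only [naturalForm_eq_trace, Matrix.sub_mul, trace_sub]
  ring

/-- The Christoffel symbols of the left-invariant metric on the vectors `P Ω`, `P W`: since
`D_V (x⁻¹) = -P⁻¹ V P⁻¹`, all derivatives of the metric are products in the Lie algebra. -/
theorem christoffelFirst_slMetric {P : Matrix (Fin n) (Fin n) ℝ} (hP : IsUnit P)
    (Ω W : Matrix (Fin n) (Fin n) ℝ) :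
    christoffelFirst (slMetric α β) P (P * Ω) (P * Ω) (P * W)
      = -naturalForm α β (Ω * Ω) W - naturalForm α β Ω (Ω * W - W * Ω) := by
  have hd : IsUnit P.det := (Matrix.isUnit_iff_isUnit_det _).1 hP
  refine (christoffelFirst_eq_of_hasDerivAt (differentiableAt_slMetric hP)
    (hasDerivAt_slMetric_add_smul hP _ _ _) (hasDerivAt_slMetric_add_smul hP _ _ _)
    (hasDerivAt_slMetric_add_smul hP _ _ _)).trans ?_
  simp only [Matrix.nonsing_inv_mul_cancel_left _ _ hd, naturalForm_neg_left,
    naturalForm_comm Ω (-_), naturalForm_comm Ω, naturalForm_sub_left]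
  ring

end NaturalForm

/-! ### Geodesics of `SL(n, ℝ)` -/

section Geodesics

variable {n : ℕ} {α β : ℝ}

/-- The Euler–Arnold equation `⟨A, W⟩ = ⟨Ω, [Ω, W]⟩`, solved for `A`. With `S = sym Ω` and
`K = skew Ω` the right-hand side is `(α - β) Tr([S, K] W)`; as `[S, K]` is symmetric, `A` is
symmetric too. -/
theorem eq_smul_commutator_of_naturalForm_eq (hα : α ≠ 0) (hβ : β ≠ 0)
    {Ω A : Matrix (Fin n) (Fin n) ℝ} (hA : A.trace = 0)
    (h : ∀ W : Matrix (Fin n) (Fin n) ℝ, W.trace = 0 →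
      naturalForm α β A W = naturalForm α β Ω (Ω * W - W * Ω)) :
    A = (1 - β / α) • (symPart Ω * skewPart Ω - skewPart Ω * symPart Ω) := by
  set S := symPart Ω
  set K := skewPart Ω
  have hS : Sᵀ = S := transpose_symPart Ω
  have hK : Kᵀ = -K := transpose_skewPart Ω
  have hΩ : Ω = S + K := (symPart_add_skewPart Ω).symm
  set C := S * K - K * S with hC
  have hCt : Cᵀ = C := by
    simp only [hC, Matrix.transpose_sub, Matrix.transpose_mul, hS, hK, Matrix.neg_mul,
      Matrix.mul_neg]
    abel
  have hCtr : C.trace = 0 := by rw [hC, trace_sub, Matrix.trace_mul_comm, sub_self]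
  -- The equation says that `M` is orthogonal to all traceless matrices.
  set M := α • symPart A + β • skewPart A - (α - β) • C with hM
  have hMtr : M.trace = 0 := by
    rw [hM, trace_sub, trace_add, trace_smul, trace_smul, trace_smul, trace_symPart,
      trace_skewPart, hA, hCtr]
    simp
  have hMW : ∀ W : Matrix (Fin n) (Fin n) ℝ, W.trace = 0 → (M * W).trace = 0 := by
    intro W hW
    have h1 := h W hW
    rw [naturalForm_eq_trace_mul, naturalForm_eq_trace_mul] at h1
    -- `Tr(X [Ω, W]) = Tr([X, Ω] W)`
    have h2 : ((α • S + β • K) * (Ω * W - W * Ω)).trace = ((α - β) • C * W).trace := by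
      have h3 : (α - β) • C = (α • S + β • K) * Ω - Ω * (α • S + β • K) := by
        rw [hC, hΩ]
        simp only [Matrix.mul_add, Matrix.add_mul, Matrix.smul_mul, Matrix.mul_smul]
        module
      rw [h3, Matrix.mul_sub, Matrix.sub_mul, trace_sub, trace_sub, ← Matrix.mul_assoc,
        ← Matrix.mul_assoc, Matrix.trace_mul_comm (_ * W) Ω, Matrix.mul_assoc Ω]
    rw [hM, Matrix.sub_mul, trace_sub, h1, h2, sub_self]
  -- `M` is itself traceless, so that `W = Mᵀ` is admissible.
  have hM0 : M = 0 := by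
    have h1 := hMW Mᵀ (by rw [trace_transpose, hMtr])
    rw [← Matrix.conjTranspose_eq_transpose_of_trivial] at h1
    exact Matrix.trace_mul_conjTranspose_self_eq_zero_iff.1 h1
  -- Transposing `M = 0` separates its symmetric from its skew-symmetric part.
  have hM0t : α • symPart A - β • skewPart A - (α - β) • C = 0 := by
    have h1 := congrArg Matrix.transpose hM0
    simpa [hM, Matrix.transpose_sub, Matrix.transpose_add, Matrix.transpose_smul, hCt,
      transpose_symPart, transpose_skewPart, ← sub_eq_add_neg] using h1
  have hkA : skewPart A = 0 := by
    have h1 : (2 * β) • skewPart A = 0 := by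
      rw [← sub_eq_zero.2 (hM0.trans hM0t.symm), hM]
      module
    exact (smul_eq_zero.1 h1).resolve_left (mul_ne_zero two_ne_zero hβ)
  have hsA : α • symPart A = (α - β) • C := by
    rw [hM, hkA, smul_zero, add_zero] at hM0
    exact sub_eq_zero.1 hM0
  rw [← symPart_add_skewPart A, hkA, add_zero, ← inv_smul_smul₀ hα (symPart A), hsA, smul_smul]
  congr 1
  field_simp

theorem mul_mem_tangentVectors_specialLinearGroup (g : SpecialLinearGroup (Fin n) ℝ)
    {W : Matrix (Fin n) (Fin n) ℝ} (hW : W.trace = 0) :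
    (g : Matrix (Fin n) (Fin n) ℝ) * W ∈ tangentVectors
      (Set.range fun u : SpecialLinearGroup (Fin n) ℝ => (u : Matrix (Fin n) (Fin n) ℝ))
      (g : Matrix (Fin n) (Fin n) ℝ) := by
  have hc : ContDiff ℝ ∞
      (fun s : ℝ => (g : Matrix (Fin n) (Fin n) ℝ) * NormedSpace.exp (s • W)) :=
    contDiff_const.matrix_mul (contDiff_matrix_exp_smul W)
  have h0 : (g : Matrix (Fin n) (Fin n) ℝ) * NormedSpace.exp ((0 : ℝ) • W) = g := by simp
  have hd : HasDerivAt (fun s : ℝ => (g : Matrix (Fin n) (Fin n) ℝ) * NormedSpace.exp (s • W))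
      ((g : Matrix (Fin n) (Fin n) ℝ) * W) 0 := by
    simpa using (hasDerivAt_const 0 (g : Matrix (Fin n) (Fin n) ℝ)).matrix_mul
      (hasDerivAt_matrix_exp_smul W 0)
  refine ⟨_, hc, fun s => ?_, h0, hd.deriv⟩
  exact ⟨g * ⟨_, det_matrix_exp_smul hW s⟩, rfl⟩

theorem trace_inv_mul_eq_zero_of_hasDerivAt {G : ℝ → Matrix (Fin n) (Fin n) ℝ}
    (hG : ∀ s, (G s).det = 1) {V : Matrix (Fin n) (Fin n) ℝ} {t : ℝ} (h : HasDerivAt G V t) :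
    ((G t)⁻¹ * V).trace = 0 := by
  have hu : IsUnit (G t) := (Matrix.isUnit_iff_isUnit_det _).2 (by rw [hG]; exact isUnit_one)
  have h1 := h.matrix_det hu
  simp only [hG, one_mul] at h1
  exact h1.unique (hasDerivAt_const t 1)

/-- The body velocity `Ω = G⁻¹ Ġ` of a geodesic `G` satisfies `Ω' = k [sym Ω, skew Ω]`. -/
theorem hasDerivAt_inv_mul_deriv_of_isRiemannianGeodesicOn (hα : α ≠ 0) (hβ : β ≠ 0) {J : Set ℝ}
    (hJ : IsOpen J) {G Ω : ℝ → Matrix (Fin n) (Fin n) ℝ} (hG : ∀ s, (G s).det = 1)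
    (hgeo : IsRiemannianGeodesicOn
      (Set.range fun u : SpecialLinearGroup (Fin n) ℝ => (u : Matrix (Fin n) (Fin n) ℝ))
      (slMetric α β) G J)
    (hΩ : ∀ s, Ω s = (G s)⁻¹ * deriv G s) {t : ℝ} (ht : t ∈ J) :
    (Ω t).trace = 0 ∧ HasDerivAt G (G t * Ω t) t ∧
    HasDerivAt Ω ((1 - β / α) • (symPart (Ω t) * skewPart (Ω t) - skewPart (Ω t) * symPart (Ω t)))
      t := by
  obtain ⟨-, hC2, hgeo⟩ := hgeo
  have hud : ∀ s, IsUnit (G s).det := fun s => by rw [hG]; exact isUnit_one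
  have hu : ∀ s, IsUnit (G s) := fun s => (Matrix.isUnit_iff_isUnit_det _).2 (hud s)
  have hGΩ : ∀ s, deriv G s = G s * Ω s := fun s => by
    rw [hΩ, Matrix.mul_nonsing_inv_cancel_left _ _ (hud s)]
  have htr : ∀ s ∈ J, (Ω s).trace = 0 := fun s hs => by
    rw [hΩ]
    exact trace_inv_mul_eq_zero_of_hasDerivAt hG (hC2.hasDerivAt_deriv_of_isOpen hJ hs).1
  have h1 : HasDerivAt G (G t * Ω t) t := hGΩ t ▸ (hC2.hasDerivAt_deriv_of_isOpen hJ ht).1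
  obtain ⟨D, h2⟩ : ∃ D, HasDerivAt (deriv G) D t :=
    ⟨_, (hC2.hasDerivAt_deriv_of_isOpen hJ ht).2⟩
  have hder : HasDerivAt Ω ((G t)⁻¹ * D - Ω t * Ω t) t := by
    have h3 := (h1.matrix_inv (hu t)).matrix_mul h2
    rw [← funext hΩ] at h3
    refine h3.congr_deriv ?_
    rw [hGΩ, Matrix.nonsing_inv_mul_cancel_left _ _ (hud t), Matrix.neg_mul, Matrix.mul_assoc,
      Matrix.nonsing_inv_mul_cancel_left _ _ (hud t), sub_eq_neg_add]
  set A := (G t)⁻¹ * D - Ω t * Ω t with hA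
  have hAtr : A.trace = 0 := by
    have h0 : (fun s => (Ω s).trace) =ᶠ[nhds t] fun _ => 0 :=
      Filter.eventuallyEq_of_mem (hJ.mem_nhds ht) htr
    exact (hder.matrix_trace.congr_of_eventuallyEq h0.symm).unique (hasDerivAt_const t 0)
  have hEA : ∀ W : Matrix (Fin n) (Fin n) ℝ, W.trace = 0 →
      naturalForm α β A W = naturalForm α β (Ω t) (Ω t * W - W * Ω t) := by
    intro W hW
    have hw := mul_mem_tangentVectors_specialLinearGroup ⟨G t, hG t⟩ hW
    have h3 := (hgeo t ht).eq_of_hasDerivAt hw h1 h2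
    have h4 : naturalForm α β ((G t)⁻¹ * 0) W = 0 := by
      simp [naturalForm_eq_trace]
    rw [christoffelFirst_slMetric (hu t)] at h3
    simp only [slMetric, Matrix.nonsing_inv_mul_cancel_left _ _ (hud t), h4] at h3
    rw [hA, naturalForm_sub_left]
    linarith
  refine ⟨htr t ht, h1, ?_⟩
  rw [← eq_smul_commutator_of_naturalForm_eq hα hβ hAtr hEA]
  exact hder

theorem HasDerivAt.skewPart {F : ℝ → Matrix (Fin n) (Fin n) ℝ} {F' : Matrix (Fin n) (Fin n) ℝ}
    {t : ℝ} (hF : HasDerivAt F F' t) :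
    HasDerivAt (fun s => skewPart (F s)) (skewPart F') t :=
  (hF.sub hF.matrix_transpose).const_smul (1 / 2 : ℝ)

/-- The solution of `G' = G Ω`, `Ω' = k [sym Ω, skew Ω]`. As `skew Ω = K` is constant,
`e^{skK} (Ω - k K) e^{-skK}` is constant along the solution, and it is the body velocity of
`G e^{-skK}`, which is therefore a translate of a one-parameter group. -/
theorem eq_mul_exp_mul_exp_of_hasDerivAt {J : Set ℝ} (hJo : IsOpen J) (hJc : J.OrdConnected)
    {k : ℝ} {G Ω : ℝ → Matrix (Fin n) (Fin n) ℝ} (hG : ∀ t ∈ J, HasDerivAt G (G t * Ω t) t)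
    (hΩ : ∀ t ∈ J, HasDerivAt Ω
      (k • (symPart (Ω t) * skewPart (Ω t) - skewPart (Ω t) * symPart (Ω t))) t)
    {t₀ t : ℝ} (ht₀ : t₀ ∈ J) (ht : t ∈ J) :
    G t = G t₀ * NormedSpace.exp ((t - t₀) • (Ω t₀ - k • skewPart (Ω t₀)))
      * NormedSpace.exp ((t - t₀) • k • skewPart (Ω t₀)) := by
  set K := skewPart (Ω t₀)
  set X := Ω t₀ - k • K
  -- The derivative of `Ω` is symmetric.
  have hKc : ∀ s ∈ J, skewPart (Ω s) = K := by
    intro s hs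
    refine eq_of_hasDerivAt_zero (f := fun s => skewPart (Ω s)) hJo hJc (fun r hr => ?_) hs ht₀
    refine (hΩ r hr).skewPart.congr_deriv ?_
    simp only [skewPart, symPart, Matrix.transpose_smul, Matrix.transpose_sub,
      Matrix.transpose_add, Matrix.transpose_mul, Matrix.transpose_transpose, Matrix.smul_mul,
      Matrix.mul_smul, Matrix.mul_sub, Matrix.sub_mul, Matrix.mul_add, Matrix.add_mul]
    module
  have hE : ∀ s, HasDerivAt (fun r => NormedSpace.exp ((r - t₀) • k • K))
      (NormedSpace.exp ((s - t₀) • k • K) * (k • K)) s := fun s =>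
    (hasDerivAt_matrix_exp_smul (k • K) (s - t₀)).comp_sub_const s t₀
  have hE' : ∀ Z : Matrix (Fin n) (Fin n) ℝ, ∀ s,
      HasDerivAt (fun r => NormedSpace.exp ((-(r - t₀)) • Z))
      (-(Z * NormedSpace.exp ((-(s - t₀)) • Z))) s := by
    intro Z s
    have h1 : HasDerivAt (fun r : ℝ => -(r - t₀)) (-1) s := ((hasDerivAt_id s).sub_const t₀).neg
    have h2 := HasDerivAt.scomp s (hasDerivAt_matrix_exp_smul Z (-(s - t₀))) h1
    rw [neg_one_smul, matrix_exp_smul_mul_comm] at h2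
    exact h2
  -- The conjugated body velocity is constant.
  have hY : ∀ s ∈ J, NormedSpace.exp ((s - t₀) • k • K) * (Ω s - k • K)
      * NormedSpace.exp ((-(s - t₀)) • k • K) = X := by
    intro s hs
    -- Its derivative is the conjugate of `[k K, Ω - k K] + Ω' = 0`.
    have h1 : ∀ r ∈ J, HasDerivAt (fun r => NormedSpace.exp ((r - t₀) • k • K) * (Ω r - k • K)
        * NormedSpace.exp ((-(r - t₀)) • k • K)) 0 r := by
      intro r hr
      refine (((hE r).matrix_mul ((hΩ r hr).sub_const (k • K))).matrix_mul
        (hE' (k • K) r)).congr_deriv ?_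
      have h2 : symPart (Ω r) = Ω r - K := by
        rw [← hKc r hr]; exact eq_sub_of_add_eq (symPart_add_skewPart (Ω r))
      rw [hKc r hr, h2]
      simp only [Matrix.mul_neg, ← Matrix.mul_assoc, ← Matrix.sub_mul, ← sub_eq_add_neg]
      refine (congrArg (· * NormedSpace.exp (-(r - t₀) • k • K)) ?_).trans (Matrix.zero_mul _)
      simp only [Matrix.mul_assoc, ← Matrix.mul_add, ← Matrix.mul_sub]
      refine (congrArg (NormedSpace.exp ((r - t₀) • k • K) * ·) ?_).trans (Matrix.mul_zero _)
      simp only [Matrix.sub_mul, Matrix.mul_sub, Matrix.smul_mul, Matrix.mul_smul]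
      module
    have h3 := eq_of_hasDerivAt_zero hJo hJc h1 hs ht₀
    simpa using h3
  -- `Z = G e^{-skK}` solves `Z' = Z X`, so that `Z e^{-sX}` is constant.
  have hZ : ∀ r ∈ J, HasDerivAt (fun r => G r * NormedSpace.exp ((-(r - t₀)) • k • K)
      * NormedSpace.exp ((-(r - t₀)) • X)) 0 r := by
    intro r hr
    refine (((hG r hr).matrix_mul (hE' (k • K) r)).matrix_mul (hE' X r)).congr_deriv ?_
    have h1 : (Ω r - k • K) * NormedSpace.exp ((-(r - t₀)) • k • K)
        = NormedSpace.exp ((-(r - t₀)) • k • K) * X := by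
      rw [← hY r hr, Matrix.mul_assoc (NormedSpace.exp ((r - t₀) • k • K)), ← Matrix.mul_assoc,
        matrix_exp_neg_mul_exp_smul, Matrix.one_mul]
    rw [Matrix.mul_neg, ← sub_eq_add_neg, Matrix.mul_neg, ← sub_eq_add_neg, Matrix.mul_assoc (G r),
      ← Matrix.mul_sub, ← Matrix.sub_mul, h1]
    simp only [Matrix.mul_assoc, sub_self]
  have h4 := eq_of_hasDerivAt_zero hJo hJc hZ ht ht₀
  simp only [sub_self, neg_zero, zero_smul, NormedSpace.exp_zero, Matrix.mul_one] at h4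
  rw [← h4, Matrix.mul_assoc _ (NormedSpace.exp ((-(t - t₀)) • X)), matrix_exp_neg_mul_exp_smul,
    Matrix.mul_one, Matrix.mul_assoc, matrix_exp_neg_mul_exp_smul, Matrix.mul_one]

end Geodesics

/-! ### Orbits of one-parameter groups in `SL(n, ℝ) / SO(n)` -/

section SymmetricSpace

variable {n : ℕ} {α : ℝ}

theorem differentiableAt_symSpaceMetric {P : Matrix (Fin n) (Fin n) ℝ} (hP : IsUnit P)
    (V W : Matrix (Fin n) (Fin n) ℝ) :
    DifferentiableAt ℝ (fun x => symSpaceMetric α x V W) P := by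
  have h : ∀ Z : Matrix (Fin n) (Fin n) ℝ,
      DifferentiableAt ℝ (fun x : Matrix (Fin n) (Fin n) ℝ => x⁻¹ * Z) P := fun Z =>
    (differentiableAt_matrix_inv hP).matrix_mul (differentiableAt_const Z)
  exact ((h V).matrix_mul (h W)).matrix_trace.const_mul _

theorem hasDerivAt_symSpaceMetric_add_smul {P : Matrix (Fin n) (Fin n) ℝ} (hP : IsUnit P)
    (U V W : Matrix (Fin n) (Fin n) ℝ) :
    HasDerivAt (fun s : ℝ => symSpaceMetric α (P + s • U) V W)
      (α / 4 * (-(P⁻¹ * U * (P⁻¹ * V)) * (P⁻¹ * W)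
        + P⁻¹ * V * -(P⁻¹ * U * (P⁻¹ * W))).trace) 0 := by
  have h0 : P + (0 : ℝ) • U = P := by simp
  have h := ((hasDerivAt_inv_add_smul_mul hP U V).matrix_mul
    (hasDerivAt_inv_add_smul_mul hP U W)).matrix_trace.const_mul (α / 4)
  simpa only [symSpaceMetric, h0] using h

/-- The Levi-Civita connection of `P ↦ α / 4 Tr(P⁻¹ V P⁻¹ W)`: `Γ(V, V) = -V P⁻¹ V`. -/
theorem christoffelFirst_symSpaceMetric {P : Matrix (Fin n) (Fin n) ℝ} (hP : IsUnit P)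
    (V W : Matrix (Fin n) (Fin n) ℝ) :
    christoffelFirst (symSpaceMetric α) P V V W = -symSpaceMetric α P (V * P⁻¹ * V) W := by
  refine (christoffelFirst_eq_of_hasDerivAt (differentiableAt_symSpaceMetric hP)
    (hasDerivAt_symSpaceMetric_add_smul hP _ _ _) (hasDerivAt_symSpaceMetric_add_smul hP _ _ _)
    (hasDerivAt_symSpaceMetric_add_smul hP _ _ _)).trans ?_
  have h1 : P⁻¹ * (V * P⁻¹ * V) = P⁻¹ * V * (P⁻¹ * V) := by simp only [Matrix.mul_assoc]
  rw [symSpaceMetric, h1]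
  generalize P⁻¹ * V = a
  generalize P⁻¹ * W = w
  simp only [trace_add, Matrix.neg_mul, Matrix.mul_neg, trace_neg, ← Matrix.mul_assoc]
  rw [Matrix.trace_mul_comm (w * a) a, ← Matrix.mul_assoc, Matrix.trace_mul_comm (a * w) a,
    ← Matrix.mul_assoc]
  ring

theorem symSpaceMetric_sub_left (P V V' W : Matrix (Fin n) (Fin n) ℝ) :
    symSpaceMetric α P (V - V') W = symSpaceMetric α P V W - symSpaceMetric α P V' W := by
  simp only [symSpaceMetric, Matrix.sub_mul, trace_sub, mul_sub]

/-- Congruence by `b` is an isometry from the identity to `b bᵀ`. -/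
theorem symSpaceMetric_mul_transpose {b : Matrix (Fin n) (Fin n) ℝ} (hb : IsUnit b)
    (Z Z' : Matrix (Fin n) (Fin n) ℝ) :
    symSpaceMetric α (b * bᵀ) (b * Z * bᵀ) (b * Z' * bᵀ) = α / 4 * (Z * Z').trace := by
  have hd : IsUnit b.det := (Matrix.isUnit_iff_isUnit_det _).1 hb
  have hdt : IsUnit bᵀ.det := by rwa [det_transpose]
  have key : ∀ Z : Matrix (Fin n) (Fin n) ℝ, (b * bᵀ)⁻¹ * (b * Z * bᵀ) = bᵀ⁻¹ * (Z * bᵀ) := by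
    intro Z
    rw [Matrix.mul_inv_rev, Matrix.mul_assoc, Matrix.mul_assoc b,
      nonsing_inv_mul_cancel_left _ _ hd]
  rw [symSpaceMetric, key, key, Matrix.mul_assoc, Matrix.mul_assoc Z,
    mul_nonsing_inv_cancel_left _ _ hdt, Matrix.trace_mul_comm, Matrix.mul_assoc, Matrix.mul_assoc,
    mul_nonsing_inv _ hdt, Matrix.mul_one]

theorem mul_mul_transpose_mem_tangentVectors_symSpace {b : Matrix (Fin n) (Fin n) ℝ}
    (hb : b.det = 1) {Z : Matrix (Fin n) (Fin n) ℝ} (hZ : Zᵀ = Z) (hZtr : Z.trace = 0) :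
    b * Z * bᵀ ∈ tangentVectors
      (Set.range (symSpaceEmb : SymSpace n → Matrix (Fin n) (Fin n) ℝ)) (b * bᵀ) := by
  have hc : ContDiff ℝ ∞ (fun s : ℝ => b * NormedSpace.exp (s • Z) * bᵀ) :=
    (contDiff_const.matrix_mul (contDiff_matrix_exp_smul Z)).matrix_mul contDiff_const
  have h0 : b * NormedSpace.exp ((0 : ℝ) • Z) * bᵀ = b * bᵀ := by simp
  have hd : HasDerivAt (fun s : ℝ => b * NormedSpace.exp (s • Z) * bᵀ) (b * Z * bᵀ) 0 := by
    simpa using ((hasDerivAt_const 0 b).matrix_mul (hasDerivAt_matrix_exp_smul Z 0)).matrix_mul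
      (hasDerivAt_const 0 bᵀ)
  refine ⟨_, hc, fun s => ?_, h0, hd.deriv⟩
  -- `b e^{sZ} bᵀ` is the image of the coset of `b e^{(s/2)Z}`.
  have hdet : (b * NormedSpace.exp ((s / 2) • Z)).det = 1 := by
    rw [Matrix.det_mul, hb, det_matrix_exp_smul hZtr, one_mul]
  let u : SpecialLinearGroup (Fin n) ℝ := ⟨_, hdet⟩
  refine ⟨(u : SymSpace n), (symSpaceEmb_mk u).trans ?_⟩
  change b * NormedSpace.exp ((s / 2) • Z) * (b * NormedSpace.exp ((s / 2) • Z))ᵀ = _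
  simp only [Matrix.transpose_mul, ← Matrix.exp_transpose, Matrix.transpose_smul, hZ]
  rw [← Matrix.mul_assoc, Matrix.mul_assoc b, ← matrix_exp_add_smul, add_halves]

/-- For `b' = b Y`, the covariant derivative of the velocity of `b bᵀ` is `b [Y, Yᵀ] bᵀ`. -/
theorem isCovDerivVelocity_mul_transpose {b c : ℝ → Matrix (Fin n) (Fin n) ℝ}
    {Y : Matrix (Fin n) (Fin n) ℝ} (hb : ∀ s, HasDerivAt b (b s * Y) s) {s : ℝ}
    (hdet : (b s).det = 1) (hc : ∀ᶠ r in nhds s, c r = b r * (b r)ᵀ) :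
    IsCovDerivVelocity (Set.range (symSpaceEmb : SymSpace n → Matrix (Fin n) (Fin n) ℝ))
      (symSpaceMetric α) c s (b s * (Y * Yᵀ - Yᵀ * Y) * (b s)ᵀ) := by
  have hud : IsUnit (b s).det := by rw [hdet]; exact isUnit_one
  have hudt : IsUnit ((b s)ᵀ).det := by rwa [det_transpose]
  have hd1 : ∀ r, HasDerivAt (fun r => b r * (b r)ᵀ) (b r * (Y + Yᵀ) * (b r)ᵀ) r := fun r => by
    refine ((hb r).matrix_mul (hb r).matrix_transpose).congr_deriv ?_
    simp only [Matrix.transpose_mul, Matrix.mul_add, Matrix.add_mul, Matrix.mul_assoc]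
  have hd2 : HasDerivAt (fun r => b r * (Y + Yᵀ) * (b r)ᵀ)
      (b s * (Y * (Y + Yᵀ) + (Y + Yᵀ) * Yᵀ) * (b s)ᵀ) s := by
    refine (((hb s).matrix_mul (hasDerivAt_const s (Y + Yᵀ))).matrix_mul
      (hb s).matrix_transpose).congr_deriv ?_
    simp only [Matrix.transpose_mul, Matrix.mul_add, Matrix.add_mul, Matrix.mul_assoc,
      Matrix.mul_zero, add_zero]
  have hcd : ∀ᶠ r in nhds s, HasDerivAt c (b r * (Y + Yᵀ) * (b r)ᵀ) r :=
    hc.eventually_nhds.mono fun r hr => (hd1 r).congr_of_eventuallyEq hr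
  have hcs : c s = b s * (b s)ᵀ := hc.self_of_nhds
  have hP : IsUnit (b s * (b s)ᵀ) :=
    (Matrix.isUnit_iff_isUnit_det _).2 (by rw [Matrix.det_mul]; exact hud.mul hudt)
  refine isCovDerivVelocity_of_hasDerivAt hcd hd2 ?_ fun w => ?_
  · rw [hcs]
    refine mul_mul_transpose_mem_tangentVectors_symSpace hdet ?_ ?_
    · simp [Matrix.transpose_sub, Matrix.transpose_mul]
    · rw [trace_sub, Matrix.trace_mul_comm, sub_self]
  · rw [hcs, christoffelFirst_symSpaceMetric hP, ← sub_eq_add_neg, ← symSpaceMetric_sub_left]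
    congr 1
    have h1 : b s * (Y + Yᵀ) * (b s)ᵀ * (b s * (b s)ᵀ)⁻¹ * (b s * (Y + Yᵀ) * (b s)ᵀ)
        = b s * ((Y + Yᵀ) * (Y + Yᵀ)) * (b s)ᵀ := by
      simp only [Matrix.mul_inv_rev, Matrix.mul_assoc, mul_nonsing_inv_cancel_left _ _ hudt,
        nonsing_inv_mul_cancel_left _ _ hud]
    rw [h1, ← Matrix.sub_mul, ← Matrix.mul_sub]
    congr 2
    simp only [Matrix.mul_add, Matrix.add_mul]
    abel

/-- The squared speed of the orbit of `s ↦ e^{sX}` is positive unless `X` is skew-symmetric. -/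
theorem trace_add_transpose_mul_self_pos {X : Matrix (Fin n) (Fin n) ℝ} (hX : X + Xᵀ ≠ 0) :
    0 < ((X + Xᵀ) * (X + Xᵀ)).trace := by
  have h1 : (X + Xᵀ)ᴴ = X + Xᵀ := by
    rw [Matrix.conjTranspose_eq_transpose_of_trivial]
    simp [add_comm]
  have h2 := (Matrix.posSemidef_self_mul_conjTranspose (X + Xᵀ)).trace_nonneg
  have h3 := mt (Matrix.trace_mul_conjTranspose_self_eq_zero_iff (A := X + Xᵀ)).1 hX
  rw [h1] at h2 h3
  exact lt_of_le_of_ne h2 (Ne.symm h3)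

/-- A translated orbit of a one-parameter group, if not constant, has constant speed and constant
geodesic curvature: all its points are equivalent under isometries. -/
theorem exists_hasConstantGeodesicCurvatureOn_orbit (hα : 0 < α) {J : Set ℝ} (hJo : IsOpen J)
    (hJc : J.OrdConnected) {a X : Matrix (Fin n) (Fin n) ℝ} (ha : a.det = 1) (hX : X.trace = 0)
    (hXs : X + Xᵀ ≠ 0) (t₀ : ℝ) {c : ℝ → Matrix (Fin n) (Fin n) ℝ}
    (hc : ∀ t ∈ J, c t = a * NormedSpace.exp ((t - t₀) • X)
      * (a * NormedSpace.exp ((t - t₀) • X))ᵀ) :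
    ∃ κ : ℝ, HasConstantGeodesicCurvatureOn
      (Set.range (symSpaceEmb : SymSpace n → Matrix (Fin n) (Fin n) ℝ)) (symSpaceMetric α)
      c J κ := by
  -- `v` is the speed of the orbit.
  set q := α / 4 * ((X + Xᵀ) * (X + Xᵀ)).trace with hq
  have hq0 : 0 < q := mul_pos (by positivity) (trace_add_transpose_mul_self_pos hXs)
  set v := √q
  have hv0 : 0 < v := Real.sqrt_pos.2 hq0
  have hvv : v * v = q := Real.mul_self_sqrt hq0.le
  set θ : ℝ → ℝ := fun s => v⁻¹ * s
  have hθc : ContDiff ℝ ∞ θ := contDiff_const.mul contDiff_id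
  have hθm : StrictMono θ := fun s r h => mul_lt_mul_of_pos_left h (inv_pos.2 hv0)
  have hIo : IsOpen (θ ⁻¹' J) := hJo.preimage hθc.continuous
  set Y := v⁻¹ • X with hY
  set b : ℝ → Matrix (Fin n) (Fin n) ℝ := fun s => a * NormedSpace.exp ((θ s - t₀) • X) with hb
  have hdet : ∀ s, (b s).det = 1 := fun s => by
    rw [hb, Matrix.det_mul, ha, det_matrix_exp_smul hX, one_mul]
  have hbu : ∀ s, IsUnit (b s) := fun s =>
    (Matrix.isUnit_iff_isUnit_det _).2 (by rw [hdet]; exact isUnit_one)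
  have hbd : ∀ s, HasDerivAt b (b s * Y) s := by
    intro s
    have h1 : HasDerivAt (fun s => θ s - t₀) v⁻¹ s := by
      simpa using ((hasDerivAt_id s).const_mul v⁻¹).sub_const t₀
    have h2 := HasDerivAt.scomp s (hasDerivAt_matrix_exp_smul X (θ s - t₀)) h1
    refine ((hasDerivAt_const s a).matrix_mul h2).congr_deriv ?_
    simp only [hb, hY, Matrix.zero_mul, zero_add, Matrix.mul_smul, Matrix.mul_assoc]
  have hbc : ContDiff ℝ ∞ b :=
    contDiff_const.matrix_mul ((contDiff_matrix_exp_smul X).comp (hθc.sub contDiff_const))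
  have hcb : Set.EqOn (c ∘ θ) (fun s => b s * (b s)ᵀ) (θ ⁻¹' J) := fun s hs => hc _ hs
  have hce : ∀ s ∈ θ ⁻¹' J, ∀ᶠ r in nhds s, (c ∘ θ) r = b r * (b r)ᵀ := fun s hs =>
    hcb.eventuallyEq_of_mem (hIo.mem_nhds hs)
  refine ⟨√(α / 4 * ((Y * Yᵀ - Yᵀ * Y) * (Y * Yᵀ - Yᵀ * Y)).trace), θ ⁻¹' J, θ, hIo,
    hJc.preimage_mono hθm.monotone, ⟨fun s hs => hs, hθm.injective.injOn, fun t ht => ?_⟩,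
    hθc.contDiffOn, hθm.strictMonoOn _, ⟨?_, fun s hs => ?_⟩, fun s hs => ?_⟩
  · have h1 : θ (v * t) = t := inv_mul_cancel_left₀ hv0.ne' t
    exact ⟨v * t, by rwa [Set.mem_preimage, h1], h1⟩
  · have h2 : ContDiff ℝ 2 (fun s => b s * (b s)ᵀ) :=
      contDiff_infty.1 (hbc.matrix_mul hbc.matrix_transpose) 2
    exact h2.contDiffOn.congr hcb
  · have hd1 : HasDerivAt (c ∘ θ) (b s * (Y + Yᵀ) * (b s)ᵀ) s := by
      refine HasDerivAt.congr_of_eventuallyEq ?_ (hce s hs)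
      refine ((hbd s).matrix_mul (hbd s).matrix_transpose).congr_deriv ?_
      simp only [Matrix.transpose_mul, Matrix.mul_add, Matrix.add_mul, Matrix.mul_assoc]
    have h3 : symSpaceMetric α ((c ∘ θ) s) (b s * (Y + Yᵀ) * (b s)ᵀ) (b s * (Y + Yᵀ) * (b s)ᵀ)
        = 1 := by
      rw [hcb hs, symSpaceMetric_mul_transpose (hbu s), hY, Matrix.transpose_smul, ← smul_add,
        Matrix.smul_mul, Matrix.mul_smul, trace_smul, trace_smul, smul_eq_mul, smul_eq_mul]
      calc _ = v⁻¹ * v⁻¹ * q := by rw [hq]; ring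
        _ = 1 := by rw [← hvv]; field_simp
    exact (congrArg (fun d => symSpaceMetric α ((c ∘ θ) s) d d) hd1.deriv).trans h3
  · refine ⟨_, isCovDerivVelocity_mul_transpose hbd (hdet s) (hce s hs), ?_⟩
    have h4 : c (θ s) = b s * (b s)ᵀ := hcb hs
    rw [h4, symSpaceMetric_mul_transpose (hbu s)]

end SymmetricSpace

/-! ### One-parameter groups of `SL(n, ℝ)` and projected geodesics -/

section OneParameterGroups

variable {n : ℕ}

/-- The one-parameter group `s ↦ e^{sX}` of `SL(n, ℝ)`, for a traceless matrix `X`. -/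
noncomputable def expHom (X : Matrix (Fin n) (Fin n) ℝ) (hX : X.trace = 0) :
    Multiplicative ℝ →* SpecialLinearGroup (Fin n) ℝ where
  toFun s := ⟨NormedSpace.exp (s.toAdd • X), det_matrix_exp_smul hX _⟩
  map_one' := Subtype.ext (by simp)
  map_mul' s r := Subtype.ext (matrix_exp_add_smul X s.toAdd r.toAdd)

theorem matrix_exp_mul_transpose_of_skew {Z : Matrix (Fin n) (Fin n) ℝ} (hZ : Zᵀ = -Z) (s : ℝ) :
    NormedSpace.exp (s • Z) * (NormedSpace.exp (s • Z))ᵀ = 1 := by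
  rw [← Matrix.exp_transpose, Matrix.transpose_smul, hZ, smul_neg, ← neg_smul,
    matrix_exp_mul_exp_neg_smul]

end OneParameterGroups

theorem mainTheorem6 (n : ℕ) (α β : ℝ) (hα : 0 < α) (hβ : β < 0)
    (J : Set ℝ) (hJo : IsOpen J) (hJc : J.OrdConnected) (t₀ : ℝ) (ht₀ : t₀ ∈ J)
    (g : ℝ → Matrix.SpecialLinearGroup (Fin n) ℝ) (hg : IsSLGeodesicOn α β g J) :
    (∃ (Ω₀ X₀ : LieAlgebra.SpecialLinear.sl (Fin n) ℝ)
        (e : Multiplicative ℝ →* Matrix.SpecialLinearGroup (Fin n) ℝ),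
      (Ω₀ : Matrix (Fin n) (Fin n) ℝ)
        = (g t₀ : Matrix (Fin n) (Fin n) ℝ)⁻¹
          * deriv (fun t => (g t : Matrix (Fin n) (Fin n) ℝ)) t₀ ∧
      (X₀ : Matrix (Fin n) (Fin n) ℝ)
        = (Ω₀ : Matrix (Fin n) (Fin n) ℝ)
          - (1 - β / α) • skewPart (Ω₀ : Matrix (Fin n) (Fin n) ℝ) ∧
      (∀ s : ℝ, (e (Multiplicative.ofAdd s) : Matrix (Fin n) (Fin n) ℝ)
        = NormedSpace.exp (s • (X₀ : Matrix (Fin n) (Fin n) ℝ))) ∧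
      (∀ t ∈ J, (g t : SymSpace n)
        = g t₀ • e (Multiplicative.ofAdd (t - t₀)) •
            ((1 : Matrix.SpecialLinearGroup (Fin n) ℝ) : SymSpace n))) ∧
    ((¬ ∀ t ∈ J, (g t : SymSpace n) = (g t₀ : SymSpace n)) →
      ∃ κ : ℝ, HasConstantGeodesicCurvatureOn
        (Set.range (symSpaceEmb : SymSpace n → Matrix (Fin n) (Fin n) ℝ)) (symSpaceMetric α)
        (fun t => symSpaceEmb (g t : SymSpace n)) J κ) := by
  have hode := fun t (ht : t ∈ J) => hasDerivAt_inv_mul_deriv_of_isRiemannianGeodesicOn hα.ne'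
    hβ.ne hJo (fun s => (g s).2) hg (fun _ => rfl) ht
  set Ω : ℝ → Matrix (Fin n) (Fin n) ℝ := fun s => (g s : Matrix (Fin n) (Fin n) ℝ)⁻¹
    * deriv (fun t => (g t : Matrix (Fin n) (Fin n) ℝ)) s
  set k := 1 - β / α
  set X := Ω t₀ - k • skewPart (Ω t₀) with hX
  have hΩtr : (Ω t₀).trace = 0 := (hode t₀ ht₀).1
  have hXtr : X.trace = 0 := by
    rw [hX, trace_sub, trace_smul, hΩtr, trace_skewPart, smul_zero, sub_zero]
  have hsol : ∀ t ∈ J, (g t : Matrix (Fin n) (Fin n) ℝ)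
      = g t₀ * NormedSpace.exp ((t - t₀) • X)
        * NormedSpace.exp ((t - t₀) • k • skewPart (Ω t₀)) := fun t ht =>
    eq_mul_exp_mul_exp_of_hasDerivAt hJo hJc (fun s hs => (hode s hs).2.1)
      (fun s hs => (hode s hs).2.2) ht₀ ht
  have hKt : (k • skewPart (Ω t₀))ᵀ = -(k • skewPart (Ω t₀)) := by
    rw [Matrix.transpose_smul, transpose_skewPart, smul_neg]
  -- The factor `e^{(t - t₀) k K}` is orthogonal and disappears in `X_n`.
  have hemb : ∀ t ∈ J, symSpaceEmb (g t : SymSpace n)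
      = g t₀ * NormedSpace.exp ((t - t₀) • X)
        * ((g t₀ : Matrix (Fin n) (Fin n) ℝ) * NormedSpace.exp ((t - t₀) • X))ᵀ := by
    intro t ht
    rw [symSpaceEmb_mk, hsol t ht, Matrix.transpose_mul (_ * _), Matrix.mul_assoc,
      ← Matrix.mul_assoc (NormedSpace.exp ((t - t₀) • k • skewPart (Ω t₀))),
      matrix_exp_mul_transpose_of_skew hKt, Matrix.one_mul]
  refine ⟨⟨⟨Ω t₀, ?_⟩, ⟨X, ?_⟩, expHom X hXtr, rfl, rfl, fun s => rfl, fun t ht => ?_⟩,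
    fun hne => ?_⟩
  · exact LinearMap.mem_ker.2 hΩtr
  · exact LinearMap.mem_ker.2 hXtr
  · refine symSpaceEmb_injective ((hemb t ht).trans ?_)
    have h1 : g t₀ • expHom X hXtr (Multiplicative.ofAdd (t - t₀)) •
        ((1 : SpecialLinearGroup (Fin n) ℝ) : SymSpace n)
        = ((g t₀ * expHom X hXtr (Multiplicative.ofAdd (t - t₀)) :
          SpecialLinearGroup (Fin n) ℝ) : SymSpace n) := by
      rw [MulAction.Quotient.smul_coe, MulAction.Quotient.smul_coe]
      simp
    rw [h1, symSpaceEmb_mk]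
    rfl
  · refine exists_hasConstantGeodesicCurvatureOn_orbit hα hJo hJc (g t₀).2 hXtr (fun h0 => hne ?_)
      t₀ hemb
    -- If `X` is skew-symmetric, its one-parameter group fixes the base point.
    intro t ht
    refine symSpaceEmb_injective ((hemb t ht).trans ?_)
    have hXt : Xᵀ = -X := eq_neg_of_add_eq_zero_right h0
    rw [symSpaceEmb_mk, Matrix.transpose_mul, Matrix.mul_assoc,
      ← Matrix.mul_assoc (NormedSpace.exp ((t - t₀) • X)),
      matrix_exp_mul_transpose_of_skew hXt, Matrix.one_mul]
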